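/- Let $M$ be a smooth (Hausdorff, second countable, finite-dimensional, boundaryless) manifold. For $k\in\mathbb Z$ let $A^k(M)=\Gamma(\wedge^kTM)$ be the space of smooth $k$-vector fields and $\Omega^k(M)$ the space of smooth $k$-forms (both $0$ for $k<0$; $A^0(M)=\Omega^0(M)=C^\infty(M)$), and let $\mathcal A(M)=\bigoplus_k A^k(M)$ with the Schouten--Nijenhuis bracket $[\cdot,\cdot]$. A $k$-form $\eta$ is evaluated on $k$-vector fields through the pairing $(\alpha^1\wedge\cdots\wedge\alpha^k)(v_1\wedge\cdots\wedge v_k)=\det(\alpha^i(v_j))$, with $\eta(f)=f\eta$ for $k=0$. A higher connection on $M$ is a map $\nabla:\mathcal A(M)\times\mathcal A(M)\to\mathcal A(M)$, $(X,Y)\mapsto\nabla_XY$, such that (i) $\nabla_XY\in A^{k+l-1}(M)$ for $X\in A^k(M)$, $Y\in A^l(M)$; (ii) $\nabla_{fX+X'}Y=f\nabla_XY+\nabla_{X'}Y$ for $f\in C^\infty(M)$ and $X,X',Y\in\mathcal A(M)$; (iii) $\nabla_X(Y+Y')=\nabla_XY+\nabla_XY'$ for $X,Y,Y'\in\mathcal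 A(M)$; (iv) $\nabla_Xf=[X,f]$ for $X\in A^k(M)$, $f\in C^\infty(M)$; (v) $\nabla_X(fY)=[X,f]\wedge Y+f\nabla_XY$ for $X\in A^k(M)$, $f\in C^\infty(M)$, $Y\in\mathcal A(M)$; (vi) $\nabla_fX=0$ for $f\in C^\infty(M)$, $X\in\mathcal A(M)$. For multivector fields $X$ and forms $\omega$ put $(i_X\omega)(Y):=\omega(X\wedge Y)$, and for $X\in A^k(M)$ put $L_X\omega:=d\,i_X\omega-(-1)^k\,i_Xd\omega$. Theorem. Let $\nabla$ be a higher connection on $M$, $X\in A^k(M)$ with $k>0$, and $\omega\in\Omega^l(M)$. For $Y\in A^{l-k+1}(M)$ put $$(\nabla_X\omega)(Y):=(-1)^{(k-1)(l-1)}L_Xi_Y\omega-\omega(\nabla_XY).$$ This expression is $C^\infty(M)$-linear in $Y$, that is, additive in $Y$ and satisfying $(\nabla_X\omega)(fY)=f\,(\nabla_X\omega)(Y)$ for $f\in C^\infty(M)$. Hence $\nabla_X\omega$ is a genuine differential form: there is exactly one $\eta\in\Omega^{l-k+1}(M)$ with $\eta(Y)=(\nabla_X\omega)(Y)$ for all $Y\in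 A^{l-k+1}(M)$. -/

import Mathlib

open scoped Manifold ContDiff

noncomputable section

namespace HigherConn

/-! ## Multilinear algebra -/

section Algebra

variable {V W : Type*} [AddCommGroup V] [Module ℝ V] [AddCommGroup W] [Module ℝ W]

/-- The homogeneous part `⋀ᵏ V` of the exterior algebra, for an integer `k`; it is `0` when
`k < 0`. -/
def gradedPart (V : Type*) [AddCommGroup V] [Module ℝ V] :
    ℤ → Submodule ℝ (ExteriorAlgebra ℝ V)
  | Int.ofNat n => ⋀[ℝ]^n V
  | Int.negSucc _ => ⊥

/-- The left contraction `α ⌋ x`: it is the antiderivation in `x` with `α ⌋ v = α v` for vectors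
`v`, so that `α ⌋ (v ∧ y) = α v • y - v ∧ (α ⌋ y)`. -/
def contractL (α : Module.Dual ℝ V) (x : ExteriorAlgebra ℝ V) : ExteriorAlgebra ℝ V :=
  CliffordAlgebra.contractLeft (Q := (0 : QuadraticForm ℝ V)) α x

/-- The right contraction `x ⌊ α`, with `(y ∧ v) ⌊ α = α v • y - (y ⌊ α) ∧ v` for vectors `v`; it
equals `(-1) ^ (k - 1) • (α ⌋ x)` on `⋀ᵏ V`. -/
def contractR (x : ExteriorAlgebra ℝ V) (α : Module.Dual ℝ V) : ExteriorAlgebra ℝ V :=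
  CliffordAlgebra.contractRight (Q := (0 : QuadraticForm ℝ V)) x α

/-- The alternating `j`-linear map `(v₁, …, vⱼ) ↦ a (v₁ ∧ ⋯ ∧ vⱼ)` given by a linear functional
`a` on the exterior algebra. -/
def altOfDual (a : Module.Dual ℝ (ExteriorAlgebra ℝ V)) (j : ℕ) : V [⋀^Fin j]→ₗ[ℝ] ℝ :=
  a.compAlternatingMap (ExteriorAlgebra.ιMulti ℝ j)

end Algebra

section Coordinates

variable {E : Type*} [NormedAddCommGroup E] [NormedSpace ℝ E] [FiniteDimensional ℝ E]

theorem continuous_alternating {j : ℕ} (a : E [⋀^Fin j]→ₗ[ℝ] ℝ) : Continuous a := by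
  let b := Module.finBasis ℝ E
  have h : (a : (Fin j → E) → ℝ) = fun v => ∑ r : Fin j → Fin (Module.finrank ℝ E),
      (∏ i, b.coord (r i) (v i)) • a (fun i => b (r i)) := by
    funext v
    have hv : v = fun i => ∑ s, b.coord s (v i) • b s := by
      funext i
      simp [b.sum_repr]
    conv_lhs => rw [hv]
    change a.toMultilinearMap _ = _
    rw [MultilinearMap.map_sum]
    refine Finset.sum_congr rfl fun r _ => ?_
    rw [MultilinearMap.map_smul_univ]
    rfl
  rw [h]
  refine continuous_finsetSum _ fun r _ => ?_
  refine Continuous.mul (continuous_finsetProd _ fun i _ => ?_) continuous_const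
  exact (LinearMap.continuous_of_finiteDimensional (b.coord (r i))).comp (continuous_apply i)

/-- An alternating form on a finite-dimensional normed space, as a continuous alternating form. -/
def toContAlt {j : ℕ} (a : E [⋀^Fin j]→ₗ[ℝ] ℝ) : E [⋀^Fin j]→L[ℝ] ℝ :=
  ⟨⟨a.toMultilinearMap, continuous_alternating a⟩, a.map_eq_zero_of_eq'⟩

/-- The derivative at `y`, in the direction `v`, of a function with values in the
finite-dimensional vector space `⋀ E`, taken coefficientwise in the basis `e_{i₁} ∧ ⋯ ∧ e_{iₖ}`
(`i₁ < ⋯ < iₖ`) of `⋀ E`. -/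
def extAlgDeriv (F : E → ExteriorAlgebra ℝ E) (y v : E) : ExteriorAlgebra ℝ E :=
  ∑ s : Finset (Fin (Module.finrank ℝ E)),
    fderiv ℝ (fun z => (Module.finBasis ℝ E).ExteriorAlgebra.coord s (F z)) y v •
      (Module.finBasis ℝ E).ExteriorAlgebra s

/-- The Schouten-Nijenhuis bracket of multivector fields on a vector space: with linear
coordinates `x¹, …, xⁿ`,
`[P, Q] = ∑ᵢ (P ⌊ dxⁱ) ∧ ∂ᵢ Q - ∑ᵢ ∂ᵢ P ∧ (dxⁱ ⌋ Q)`.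
It is the Lie bracket on vector fields, `[P, f] = P ⌊ df` for functions `f`, and
`[P, Q] = -(-1) ^ ((p - 1) * (q - 1)) [Q, P]`,
`[P, Q ∧ R] = [P, Q] ∧ R + (-1) ^ ((p - 1) * q) Q ∧ [P, R]`. -/
def schoutenE (P Q : E → ExteriorAlgebra ℝ E) (y : E) : ExteriorAlgebra ℝ E :=
  ∑ i : Fin (Module.finrank ℝ E),
    (contractR (P y) ((Module.finBasis ℝ E).coord i) *
        extAlgDeriv Q y (Module.finBasis ℝ E i)
      - extAlgDeriv P y (Module.finBasis ℝ E i) *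
        contractL ((Module.finBasis ℝ E).coord i) (Q y))

end Coordinates

/-! ## Multivector fields and differential forms on a manifold -/

section Manifold

variable (E : Type*) [NormedAddCommGroup E] [NormedSpace ℝ E]
variable (M : Type*) [TopologicalSpace M] [ChartedSpace E M] [IsManifold 𝓘(ℝ, E) ∞ M]

/-- The differential `dφ_p : T_pM → E` of the preferred chart `φ` around `x`, at a point `p` of its
domain: the trivialization of the tangent bundle by this chart. -/
def dChart (x p : M) : TangentSpace 𝓘(ℝ, E) p →ₗ[ℝ] E :=
  ((trivializationAt E (TangentSpace 𝓘(ℝ, E)) x).continuousLinearMapAt ℝ p).toLinearMap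

/-- The inverse `E → T_pM` of the differential `dφ_p` of the preferred chart `φ` around `x`, at a
point `p` of its domain, i.e. the differential at `φ p` of the inverse of `φ`. -/
def dChartSymm (x p : M) : E →ₗ[ℝ] TangentSpace 𝓘(ℝ, E) p :=
  ((trivializationAt E (TangentSpace 𝓘(ℝ, E)) x).symmL ℝ p).toLinearMap

/-- Arbitrary (not necessarily smooth) sections of the full exterior bundle `⋀ TM`. -/
abbrev RawMVF : Type _ := (p : M) → ExteriorAlgebra ℝ (TangentSpace 𝓘(ℝ, E) p)

/-- Arbitrary (not necessarily smooth) sections of the dual bundle of `⋀ TM`. -/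
abbrev RawForm : Type _ :=
  (p : M) → Module.Dual ℝ (ExteriorAlgebra ℝ (TangentSpace 𝓘(ℝ, E) p))

variable {E M}

/-- A section of `⋀ TM` read in the preferred chart `φ` around `x`, as an `⋀ E`-valued function
on (the image of the chart in) `E`. -/
def RawMVF.inChart (X : RawMVF E M) (x : M) (y : E) : ExteriorAlgebra ℝ E :=
  ExteriorAlgebra.map (dChart E M x ((extChartAt 𝓘(ℝ, E) x).symm y))
    (X ((extChartAt 𝓘(ℝ, E) x).symm y))

/-- A section of `⋀ TM` is smooth if all its components in all charts are smooth. -/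
def RawMVF.IsSmooth (X : RawMVF E M) : Prop :=
  ∀ (x : M) (a : Module.Dual ℝ (ExteriorAlgebra ℝ E)),
    ContMDiffOn 𝓘(ℝ, E) 𝓘(ℝ, ℝ) ∞
      (fun p => a (ExteriorAlgebra.map (dChart E M x p) (X p))) (chartAt E x).source

/-- A section of the dual of `⋀ TM` is smooth if its values on the constant-coefficient multivector
fields of every chart are smooth. -/
def RawForm.IsSmooth (α : RawForm E M) : Prop :=
  ∀ (x : M) (c : ExteriorAlgebra ℝ E),
    ContMDiffOn 𝓘(ℝ, E) 𝓘(ℝ, ℝ) ∞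
      (fun p => α p (ExteriorAlgebra.map (dChartSymm E M x p) c)) (chartAt E x).source

variable (E M)

/-- The space `𝒜(M) = Γ(⋀ TM) = ⨁ₖ Aᵏ(M)` of smooth multivector fields on `M`. -/
def MVF : Submodule ℝ (RawMVF E M) where
  carrier := {X | X.IsSmooth}
  zero_mem' := fun x a => by simpa using contMDiffOn_const
  add_mem' := fun {X Y} hX hY x a => by
    simp only [Pi.add_apply, map_add]
    exact (hX x a).add (hY x a)
  smul_mem' := fun c X hX x a => by
    simp only [Pi.smul_apply, map_smul, smul_eq_mul]
    exact contMDiffOn_const.mul (hX x a)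

/-- The space `Ω(M) = ⨁ₗ Ωˡ(M)` of smooth differential forms on `M`: smooth sections of the dual
of `⋀ TM`, where `⋀ˡ T*_pM` is identified with the dual of `⋀ˡ T_pM` through the pairing
`⟨β₁ ∧ ⋯ ∧ βₗ, v₁ ∧ ⋯ ∧ vₗ⟩ = det (βᵢ vⱼ)`. -/
def DForm : Submodule ℝ (RawForm E M) where
  carrier := {α | α.IsSmooth}
  zero_mem' := fun x c => contMDiffOn_const
  add_mem' := fun {α η} hα hη x c => by
    simp only [Pi.add_apply, LinearMap.add_apply]
    exact (hα x c).add (hη x c)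
  smul_mem' := fun r α hα x c => by
    simp only [Pi.smul_apply, LinearMap.smul_apply, smul_eq_mul]
    exact contMDiffOn_const.mul (hα x c)

/-- The space `Aᵏ(M) = Γ(⋀ᵏ TM)` of `k`-vector fields; it is `0` for `k < 0`. -/
def MVF.ofDegree (k : ℤ) : Submodule ℝ (MVF E M) where
  carrier := {X | ∀ p, X.1 p ∈ gradedPart (TangentSpace 𝓘(ℝ, E) p) k}
  zero_mem' := fun _ => (gradedPart _ k).zero_mem
  add_mem' := fun hX hY p => (gradedPart _ k).add_mem (hX p) (hY p)
  smul_mem' := fun c _ hX p => (gradedPart _ k).smul_mem c (hX p)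

/-- The space `Ωˡ(M)` of differential `l`-forms, i.e. of the forms which vanish on `⋀ʲ T_pM` for
all `j ≠ l`; it is `0` for `l < 0`. -/
def DForm.ofDegree (l : ℤ) : Submodule ℝ (DForm E M) where
  carrier := {α | ∀ (j : ℤ), j ≠ l → ∀ p, ∀ v ∈ gradedPart (TangentSpace 𝓘(ℝ, E) p) j,
    α.1 p v = 0}
  zero_mem' := fun _ _ _ _ _ => rfl
  add_mem' := fun {α η} hα hη j hj p v hv => by
    simp [hα j hj p v hv, hη j hj p v hv]
  smul_mem' := fun c α hα j hj p v hv => by simp [hα j hj p v hv]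

variable {E M}

/-- A smooth function, as a `0`-vector field. -/
def funMVF (f : C^∞⟮𝓘(ℝ, E), M; ℝ⟯) : MVF E M :=
  ⟨fun p => algebraMap ℝ _ (f p), fun x a => by
    have h : ∀ p : M, a (ExteriorAlgebra.map (dChart E M x p) (algebraMap ℝ _ (f p)))
        = f p * a 1 := by
      intro p
      rw [AlgHom.commutes, Algebra.algebraMap_eq_smul_one, map_smul, smul_eq_mul]
    simp only [h]
    exact f.contMDiff.contMDiffOn.mul contMDiffOn_const⟩

/-- Pointwise multiplication of multivector fields by smooth functions. -/
instance : Module C^∞⟮𝓘(ℝ, E), M; ℝ⟯ (MVF E M) where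
  smul f X := ⟨fun p => f p • X.1 p, fun x a => by
    simp only [map_smul, smul_eq_mul]
    exact f.contMDiff.contMDiffOn.mul (X.2 x a)⟩
  one_smul X := Subtype.ext (funext fun p => one_smul ℝ (X.1 p))
  mul_smul f g X := Subtype.ext (funext fun p => mul_smul (f p) (g p) (X.1 p))
  smul_zero f := Subtype.ext (funext fun p => smul_zero (f p))
  smul_add f X Y := Subtype.ext (funext fun p => smul_add (f p) (X.1 p) (Y.1 p))
  add_smul f g X := Subtype.ext (funext fun p => add_smul (f p) (g p) (X.1 p))
  zero_smul X := Subtype.ext (funext fun p => zero_smul ℝ (X.1 p))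

/-- The interior product `(i_X α)(Y) = α (X ∧ Y)`. -/
def interior (X : RawMVF E M) (α : RawForm E M) : RawForm E M :=
  fun p => (α p).comp (LinearMap.mulLeft ℝ (X p))

section FiniteDim

variable [FiniteDimensional ℝ E]

/-- The Schouten-Nijenhuis bracket of smooth multivector fields on a manifold: its value at `p` is
computed in the preferred chart around `p` (any other chart gives the same value). -/
def schouten (P Q : RawMVF E M) (p : M) : ExteriorAlgebra ℝ (TangentSpace 𝓘(ℝ, E) p) :=
  ExteriorAlgebra.map (dChartSymm E M p p)
    (schoutenE (P.inChart p) (Q.inChart p) (extChartAt 𝓘(ℝ, E) p p))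

/-- The degree `j` part of a form, pulled back to (the image in) `E` of the preferred chart
around `x`. -/
def RawForm.inChart (α : RawForm E M) (x : M) (j : ℕ) (y : E) : E [⋀^Fin j]→L[ℝ] ℝ :=
  toContAlt ((altOfDual (α ((extChartAt 𝓘(ℝ, E) x).symm y)) j).compLinearMap
    (dChartSymm E M x ((extChartAt 𝓘(ℝ, E) x).symm y)))

/-- The exterior derivative: its value at `p` is computed in the preferred chart `φ` around `p`,
as `φ^* d((φ⁻¹)^* α)` (any other chart gives the same value). -/
def extD (α : RawForm E M) : RawForm E M := fun p =>
  ExteriorAlgebra.liftAlternating fun j =>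
    match j with
    | 0 => 0
    | j + 1 =>
      (extDeriv (α.inChart p j) (extChartAt 𝓘(ℝ, E) p p)).toAlternatingMap.compLinearMap
        (dChart E M p p)

/-- The Lie derivative `L_X α = d i_X α - (-1) ^ k i_X d α` of a form along a `k`-vector field. -/
def lieD (k : ℤ) (X : RawMVF E M) (α : RawForm E M) : RawForm E M :=
  extD (interior X α) - (-1 : ℝ) ^ k • interior X (extD α)

variable (E M)

/-- A higher (affine) connection on `M`. -/
structure HigherConnection where
  /-- The map `(X, Y) ↦ ∇_X Y`. -/
  nabla : MVF E M → MVF E M → MVF E M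
  mem_ofDegree : ∀ {k l : ℤ} {X Y : MVF E M}, X ∈ MVF.ofDegree E M k → Y ∈ MVF.ofDegree E M l →
    nabla X Y ∈ MVF.ofDegree E M (k + l - 1)
  smul_add_left : ∀ (f : C^∞⟮𝓘(ℝ, E), M; ℝ⟯) (X X' Y : MVF E M),
    nabla (f • X + X') Y = f • nabla X Y + nabla X' Y
  add_right : ∀ X Y Y' : MVF E M, nabla X (Y + Y') = nabla X Y + nabla X Y'
  apply_fun : ∀ {k : ℤ} {X : MVF E M}, X ∈ MVF.ofDegree E M k →
    ∀ (f : C^∞⟮𝓘(ℝ, E), M; ℝ⟯) (p : M),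
      (nabla X (funMVF f)).1 p = schouten X.1 (funMVF f).1 p
  leibniz : ∀ {k : ℤ} {X : MVF E M}, X ∈ MVF.ofDegree E M k →
    ∀ (f : C^∞⟮𝓘(ℝ, E), M; ℝ⟯) (Y : MVF E M) (p : M),
      (nabla X (f • Y)).1 p = schouten X.1 (funMVF f).1 p * Y.1 p + f p • (nabla X Y).1 p
  along_fun : ∀ (f : C^∞⟮𝓘(ℝ, E), M; ℝ⟯) (X : MVF E M), nabla (funMVF f) X = 0

variable {E M}

/-- The expression `(∇_X α)(Y) = (-1) ^ ((k - 1) * (l - 1)) L_X i_Y α - α(∇_X Y)`, for a `k`-vector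
field `X`, an `l`-form `α` and an `(l - k + 1)`-vector field `Y`. Here `L_X i_Y α` is a `0`-form;
the function that it is equal to is its value on `1 ∈ ⋀⁰ T_pM = ℝ`. -/
def HigherConnection.covForm (C : HigherConnection E M) (k l : ℤ) (X : MVF E M) (α : DForm E M)
    (Y : MVF E M) : M → ℝ := fun p =>
  (-1 : ℝ) ^ ((k - 1) * (l - 1)) * lieD k X.1 (interior Y.1 α.1) p 1 - α.1 p ((C.nabla X Y).1 p)

end FiniteDim

end Manifold

end HigherConn

end

namespace HigherConn

/-! ### Graded signs and contractions in the exterior algebra. -/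

section Algebra

variable {V W : Type*} [AddCommGroup V] [Module ℝ V] [AddCommGroup W] [Module ℝ W]

/-! Evaluating a `0`-form means evaluating at `1`, and an exterior derivative has no component in
degree `0`. The term `d i_X i_Y ω` therefore drops out, leaving `(∇_X ω)(Y) = -(-1)^((k-1)(l-1)+k)
(d i_Y ω)(X) - ω(∇_X Y)` (`HigherConnection.covForm_apply`). Additivity is then clear.

Replacing `Y` by `fY` produces two terms without the factor `f`. The rule `d(fβ) = df ∧ β + f dβ`
(`extD_smul`), applied to `β = i_Y ω`, gives `(df ∧ i_Y ω)(X) = ω(Y ∧ (df ⌋ X))`. The Leibniz rule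
of the connection gives `ω([X, f] ∧ Y)`. Since `[X, f] = X ⌊ df = (-1)^(k-1) df ⌋ X`
(`schouten_funMVF`, `contractL_eq_contractR`), moving this `(k-1)`-vector past `Y` turns the second
into a sign times the first (`apply_schouten_mul`). For `Y` of degree `l-k+1` the signs make the two
cancel (`HigherConnection.covForm_smul`).

A function-linear map on `m`-vector fields with smooth values is a form: cut-off chart frames
express a field, near a point, through global fields with function coefficients
(`exists_form_of_tensorial`). Smoothness of the values needs `d` in one chart on its whole domain,
although it is defined at each point in that point's own chart. This chart independence is
naturality of `d` under coordinate changes (`extD_apply_ιMulti`, `extD_apply`). -/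

theorem ιMulti_mem_exteriorPower {n : ℕ} (v : Fin n → V) :
    ExteriorAlgebra.ιMulti ℝ n v ∈ ⋀[ℝ]^n V := by
  rw [← ExteriorAlgebra.ιMulti_span_fixedDegree]
  exact Submodule.subset_span ⟨v, rfl⟩

/-- Linear maps which agree on decomposable elements of `⋀ⁿ V` agree on `⋀ⁿ V`. -/
theorem eqOn_exteriorPower {n : ℕ} {f g : ExteriorAlgebra ℝ V →ₗ[ℝ] W}
    (h : ∀ v : Fin n → V, f (ExteriorAlgebra.ιMulti ℝ n v) = g (ExteriorAlgebra.ιMulti ℝ n v))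
    {x : ExteriorAlgebra ℝ V} (hx : x ∈ ⋀[ℝ]^n V) : f x = g x := by
  rw [← ExteriorAlgebra.ιMulti_span_fixedDegree] at hx
  exact LinearMap.eqOn_span (by rintro _ ⟨v, rfl⟩; exact h v) hx

theorem map_mem_exteriorPower (f : V →ₗ[ℝ] W) {n : ℕ} {x : ExteriorAlgebra ℝ V}
    (hx : x ∈ ⋀[ℝ]^n V) : ExteriorAlgebra.map f x ∈ ⋀[ℝ]^n W := by
  rw [← ExteriorAlgebra.ιMulti_span_fixedDegree] at hx
  induction hx using Submodule.span_induction with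
  | mem x h =>
    obtain ⟨v, rfl⟩ := h
    rw [ExteriorAlgebra.map_apply_ιMulti]
    exact ιMulti_mem_exteriorPower _
  | zero => simp
  | add x y _ _ hx hy => rw [map_add]; exact add_mem hx hy
  | smul a x _ hx => rw [map_smul]; exact Submodule.smul_mem _ _ hx

theorem map_mem_gradedPart (f : V →ₗ[ℝ] W) {k : ℤ} {x : ExteriorAlgebra ℝ V}
    (hx : x ∈ gradedPart V k) : ExteriorAlgebra.map f x ∈ gradedPart W k := by
  cases k with
  | ofNat n => exact map_mem_exteriorPower f hx
  | negSucc n =>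
    have : x = 0 := hx
    rw [this, map_zero]
    exact zero_mem _

theorem ι_mul_eq_of_mem {n : ℕ} (v : V) {x : ExteriorAlgebra ℝ V} (hx : x ∈ ⋀[ℝ]^n V) :
    ExteriorAlgebra.ι ℝ v * x = (-1 : ℝ) ^ n • (x * ExteriorAlgebra.ι ℝ v) := by
  refine eqOn_exteriorPower (f := LinearMap.mulLeft ℝ (ExteriorAlgebra.ι ℝ v))
    (g := (-1 : ℝ) ^ n • LinearMap.mulRight ℝ (ExteriorAlgebra.ι ℝ v)) (fun w => ?_) hx
  simp only [LinearMap.mulLeft_apply, LinearMap.smul_apply, LinearMap.mulRight_apply]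
  clear hx
  induction n with
  | zero => simp
  | succ n ih =>
    rw [ExteriorAlgebra.ιMulti_succ_apply, ← mul_assoc,
      eq_neg_of_add_eq_zero_left (ExteriorAlgebra.ι_add_mul_swap v (w 0)), neg_mul, mul_assoc, ih,
      mul_smul_comm, pow_succ, mul_assoc]
    simp

/-- Graded commutativity of the exterior product. -/
theorem mul_comm_of_mem_exteriorPower {m n : ℕ} {x y : ExteriorAlgebra ℝ V}
    (hx : x ∈ ⋀[ℝ]^m V) (hy : y ∈ ⋀[ℝ]^n V) : x * y = (-1 : ℝ) ^ (m * n) • (y * x) := by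
  refine eqOn_exteriorPower (f := LinearMap.mulRight ℝ y)
    (g := (-1 : ℝ) ^ (m * n) • LinearMap.mulLeft ℝ y) (fun w => ?_) hx
  simp only [LinearMap.mulLeft_apply, LinearMap.smul_apply, LinearMap.mulRight_apply]
  clear hx
  induction m with
  | zero => simp
  | succ m ih =>
    rw [ExteriorAlgebra.ιMulti_succ_apply, mul_assoc, ih, mul_smul_comm, ← mul_assoc,
      ι_mul_eq_of_mem _ hy, smul_mul_assoc, smul_smul, mul_assoc]
    congr 1
    ring

/-- The projection of `⋀ V` onto `⋀ⁿ V`. -/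
noncomputable def degreeProj (V : Type*) [AddCommGroup V] [Module ℝ V] (n : ℕ) :
    ExteriorAlgebra ℝ V →ₗ[ℝ] ExteriorAlgebra ℝ V :=
  GradedAlgebra.proj (fun i : ℕ => ⋀[ℝ]^i V) n

theorem degreeProj_mem (n : ℕ) (x : ExteriorAlgebra ℝ V) : degreeProj V n x ∈ ⋀[ℝ]^n V := by
  rw [degreeProj, GradedAlgebra.proj_apply]
  exact Subtype.property _

theorem degreeProj_of_mem {n : ℕ} {x : ExteriorAlgebra ℝ V} (hx : x ∈ ⋀[ℝ]^n V) :
    degreeProj V n x = x := by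
  rw [degreeProj, GradedAlgebra.proj_apply]
  exact DirectSum.decompose_of_mem_same _ hx

theorem degreeProj_of_mem_ne {m n : ℕ} (h : m ≠ n) {x : ExteriorAlgebra ℝ V}
    (hx : x ∈ ⋀[ℝ]^m V) : degreeProj V n x = 0 := by
  rw [degreeProj, GradedAlgebra.proj_apply]
  exact DirectSum.decompose_of_mem_ne _ hx h

theorem map_degreeProj (f : V →ₗ[ℝ] W) (n : ℕ) (x : ExteriorAlgebra ℝ V) :
    ExteriorAlgebra.map f (degreeProj V n x) = degreeProj W n (ExteriorAlgebra.map f x) := by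
  suffices h : (ExteriorAlgebra.map f).toLinearMap ∘ₗ degreeProj V n =
      degreeProj W n ∘ₗ (ExteriorAlgebra.map f).toLinearMap from LinearMap.congr_fun h x
  refine ExteriorAlgebra.lhom_ext fun m => ?_
  ext v
  have hv := ιMulti_mem_exteriorPower v
  simp only [LinearMap.compAlternatingMap_apply, LinearMap.comp_apply, AlgHom.toLinearMap_apply]
  by_cases h : m = n
  · subst h
    rw [degreeProj_of_mem hv, degreeProj_of_mem (map_mem_exteriorPower f hv)]
  · rw [degreeProj_of_mem_ne h hv, degreeProj_of_mem_ne h (map_mem_exteriorPower f hv), map_zero]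

theorem contractL_ι_mul (α : Module.Dual ℝ V) (v : V) (x : ExteriorAlgebra ℝ V) :
    contractL α (ExteriorAlgebra.ι ℝ v * x) =
      α v • x - ExteriorAlgebra.ι ℝ v * contractL α x :=
  CliffordAlgebra.contractLeft_ι_mul α v x

theorem contractR_mul_ι (α : Module.Dual ℝ V) (v : V) (x : ExteriorAlgebra ℝ V) :
    contractR (x * ExteriorAlgebra.ι ℝ v) α =
      α v • x - contractR x α * ExteriorAlgebra.ι ℝ v :=
  CliffordAlgebra.contractRight_mul_ι α v x

theorem contractL_algebraMap (α : Module.Dual ℝ V) (r : ℝ) :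
    contractL α (algebraMap ℝ (ExteriorAlgebra ℝ V) r) = 0 :=
  CliffordAlgebra.contractLeft_algebraMap _ α r

theorem contractL_one (α : Module.Dual ℝ V) : contractL α (1 : ExteriorAlgebra ℝ V) = 0 :=
  CliffordAlgebra.contractLeft_one _ α

theorem contractR_one (α : Module.Dual ℝ V) : contractR (1 : ExteriorAlgebra ℝ V) α = 0 :=
  CliffordAlgebra.contractRight_one _ α

/-- `contractL` as a bilinear map. -/
noncomputable def contractLₗ :
    Module.Dual ℝ V →ₗ[ℝ] ExteriorAlgebra ℝ V →ₗ[ℝ] ExteriorAlgebra ℝ V :=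
  CliffordAlgebra.contractLeft (Q := (0 : QuadraticForm ℝ V))

/-- `contractR` as a bilinear map. -/
noncomputable def contractRₗ :
    ExteriorAlgebra ℝ V →ₗ[ℝ] Module.Dual ℝ V →ₗ[ℝ] ExteriorAlgebra ℝ V :=
  CliffordAlgebra.contractRight (Q := (0 : QuadraticForm ℝ V))

theorem contractLₗ_apply (α : Module.Dual ℝ V) (x : ExteriorAlgebra ℝ V) :
    contractLₗ α x = contractL α x := rfl

theorem contractRₗ_apply (x : ExteriorAlgebra ℝ V) (α : Module.Dual ℝ V) :
    contractRₗ x α = contractR x α := rfl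

/-- Iterating the antiderivation rule moves the contraction through the factors. The resulting
signed sum over omitted vectors has the shape of the alternatization defining `extDeriv`, which is
how contractions come to describe `d`. -/
theorem contractL_ιMulti (α : Module.Dual ℝ V) {n : ℕ} (v : Fin (n + 1) → V) :
    contractL α (ExteriorAlgebra.ιMulti ℝ (n + 1) v) =
      ∑ i : Fin (n + 1), ((-1 : ℝ) ^ (i : ℕ) * α (v i)) •
        ExteriorAlgebra.ιMulti ℝ n (i.removeNth v) := by
  induction n with
  | zero =>
    rw [ExteriorAlgebra.ιMulti_succ_apply, contractL_ι_mul]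
    simp [contractL_one]
  | succ n ih =>
    rw [ExteriorAlgebra.ιMulti_succ_apply, contractL_ι_mul, ih, sub_eq_add_neg,
      Fin.sum_univ_succ (n := n + 1), Finset.mul_sum, ← Finset.sum_neg_distrib]
    congr 1
    · simp [Fin.removeNth_zero, Matrix.vecTail, Fin.tail_def, Function.comp_def]
    · refine Finset.sum_congr rfl fun i _ => ?_
      rw [mul_smul_comm, ExteriorAlgebra.ιMulti_succ_apply (v := i.succ.removeNth v), ← neg_smul]
      congr 1
      · simp [Matrix.vecTail, pow_succ]
      · congr 2
        ext j
        simp [Fin.removeNth, Matrix.vecTail]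

theorem contractL_mem_exteriorPower (α : Module.Dual ℝ V) {n : ℕ} {x : ExteriorAlgebra ℝ V}
    (hx : x ∈ ⋀[ℝ]^(n + 1) V) : contractL α x ∈ ⋀[ℝ]^n V := by
  rw [← ExteriorAlgebra.ιMulti_span_fixedDegree] at hx
  suffices h : Submodule.span ℝ (Set.range (ExteriorAlgebra.ιMulti ℝ (n + 1))) ≤
      (⋀[ℝ]^n V).comap (contractLₗ α) from h hx
  rw [Submodule.span_le]
  rintro _ ⟨v, rfl⟩
  change contractL α _ ∈ ⋀[ℝ]^n V
  rw [contractL_ιMulti]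
  exact sum_mem fun i _ => Submodule.smul_mem _ _ (ιMulti_mem_exteriorPower _)

/-- The contraction has degree `n - 1`; the exponent `n + 1` has the same parity and avoids natural
subtraction at `n = 0`. -/
theorem contractL_mul_ι_of_mem (α : Module.Dual ℝ V) (v : V) {n : ℕ} {x : ExteriorAlgebra ℝ V}
    (hx : x ∈ ⋀[ℝ]^n V) : contractL α x * ExteriorAlgebra.ι ℝ v =
      (-1 : ℝ) ^ (n + 1) • (ExteriorAlgebra.ι ℝ v * contractL α x) := by
  cases n with
  | zero =>
    -- In degree `0` the element is a scalar and its contraction vanishes, so the sign is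
    -- irrelevant.
    change x ∈ LinearMap.range (ExteriorAlgebra.ι ℝ : V →ₗ[ℝ] _) ^ 0 at hx
    rw [pow_zero, Submodule.mem_one] at hx
    obtain ⟨r, rfl⟩ := hx
    simp [contractL_algebraMap]
  | succ n =>
    rw [ι_mul_eq_of_mem v (contractL_mem_exteriorPower α hx), smul_smul, ← pow_add,
      Even.neg_one_pow ⟨n + 1, by ring⟩, one_smul]

/-- Induction peels the first vector off for the left contraction, then moves it to the far right,
where the right contraction can absorb it. The two graded commutations supply the sign. -/
theorem contractL_eq_contractR (α : Module.Dual ℝ V) {n : ℕ} {x : ExteriorAlgebra ℝ V}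
    (hx : x ∈ ⋀[ℝ]^n V) : contractL α x = (-1 : ℝ) ^ (n + 1) • contractR x α := by
  refine eqOn_exteriorPower (f := contractLₗ α) (g := (-1 : ℝ) ^ (n + 1) • contractRₗ.flip α)
    (fun v => ?_) hx
  simp only [LinearMap.smul_apply, LinearMap.flip_apply, contractLₗ_apply, contractRₗ_apply]
  clear hx
  induction n with
  | zero => simp [contractL_one, contractR_one]
  | succ n ih =>
    have hw := ιMulti_mem_exteriorPower (Matrix.vecTail v)
    have hR : contractR (ExteriorAlgebra.ιMulti ℝ n (Matrix.vecTail v)) α =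
        (-1 : ℝ) ^ (n + 1) • contractL α (ExteriorAlgebra.ιMulti ℝ n (Matrix.vecTail v)) := by
      rw [ih, smul_smul, ← mul_pow]
      simp
    rw [ExteriorAlgebra.ιMulti_succ_apply, contractL_ι_mul, ι_mul_eq_of_mem _ hw,
      ← contractRₗ_apply, map_smul, LinearMap.smul_apply, contractRₗ_apply, contractR_mul_ι, hR,
      smul_mul_assoc, contractL_mul_ι_of_mem α _ hw, smul_smul, smul_smul, ← pow_add, ← pow_add,
      Even.neg_one_pow ⟨n + 1, by ring⟩, Even.neg_one_pow ⟨n + 1, by ring⟩, one_smul, one_smul]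

/-- The alternating form `λ ∧ a` is the pairing of `a` with the contraction by `λ`. -/
theorem sum_altOfDual_removeNth (a : Module.Dual ℝ (ExteriorAlgebra ℝ V)) (α : Module.Dual ℝ V)
    {n : ℕ} (v : Fin (n + 1) → V) :
    ∑ i : Fin (n + 1), (-1 : ℝ) ^ (i : ℕ) * (α (v i) * altOfDual a n (i.removeNth v)) =
      a (contractL α (ExteriorAlgebra.ιMulti ℝ (n + 1) v)) := by
  rw [contractL_ιMulti, map_sum]
  refine Finset.sum_congr rfl fun i _ => ?_
  rw [map_smul, smul_eq_mul, mul_assoc]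
  rfl

end Algebra
-- Coordinate changes of the tangent bundle and their exterior powers.
section Charts

open Set Filter Topology

variable {E : Type*} [NormedAddCommGroup E] [NormedSpace ℝ E]
  {M : Type*} [TopologicalSpace M] [ChartedSpace E M] [IsManifold 𝓘(ℝ, E) ∞ M]

theorem dChartSymm_dChart {x q : M} (hq : q ∈ (chartAt E x).source)
    (v : TangentSpace 𝓘(ℝ, E) q) : dChartSymm E M x q (dChart E M x q v) = v :=
  (trivializationAt E (TangentSpace 𝓘(ℝ, E)) x).symmL_continuousLinearMapAt (R := ℝ)
    (by simpa using hq) v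

theorem map_dChartSymm_map_dChart {x q : M} (hq : q ∈ (chartAt E x).source)
    (z : ExteriorAlgebra ℝ (TangentSpace 𝓘(ℝ, E) q)) :
    ExteriorAlgebra.map (dChartSymm E M x q) (ExteriorAlgebra.map (dChart E M x q) z) = z := by
  have h : dChartSymm E M x q ∘ₗ dChart E M x q = LinearMap.id :=
    LinearMap.ext (dChartSymm_dChart hq)
  rw [← AlgHom.comp_apply, ExteriorAlgebra.map_comp_map, h, ExteriorAlgebra.map_id, AlgHom.id_apply]

/-- The differential at `q` of the change of coordinates from the chart around `x` to the chart
around `x'`. -/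
noncomputable def dTransition (x x' q : M) : E →ₗ[ℝ] E := dChart E M x' q ∘ₗ dChartSymm E M x q

theorem contMDiffOn_dTransition (x x' : M) (v : E) :
    ContMDiffOn 𝓘(ℝ, E) 𝓘(ℝ, E) ∞ (fun q => dTransition x x' q v)
      ((chartAt E x).source ∩ (chartAt E x').source) := by
  have h := contMDiffOn_coordChangeL (n := ∞) (IB := 𝓘(ℝ, E))
    (trivializationAt E (TangentSpace 𝓘(ℝ, E)) x) (trivializationAt E (TangentSpace 𝓘(ℝ, E)) x')
  simp only [TangentBundle.trivializationAt_baseSet] at h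
  refine (h.clm_apply (contMDiffOn_const (c := v))).congr fun q hq => ?_
  rw [ContinuousLinearEquiv.coe_coe, Bundle.Trivialization.coordChangeL_apply]
  · change (trivializationAt E (TangentSpace 𝓘(ℝ, E)) x').continuousLinearMapAt ℝ q
      ((trivializationAt E (TangentSpace 𝓘(ℝ, E)) x).symmL ℝ q v) = _
    rw [Bundle.Trivialization.continuousLinearMapAt_apply_of_mem,
      Bundle.Trivialization.symmL_apply]
    · simpa using hq.1
    · simpa using hq.2
  · simpa using hq

/-- Identifies the change of bundle trivialization with the derivative of the transition map, so
that forms in two charts are related by a genuine pullback. -/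
theorem dTransition_eq_tangentCoordChange {x x' q : M} (hq : q ∈ (chartAt E x).source)
    (hq' : q ∈ (chartAt E x').source) :
    dTransition x x' q = (tangentCoordChange 𝓘(ℝ, E) x x' q).toLinearMap := by
  ext v
  change (trivializationAt E (TangentSpace 𝓘(ℝ, E)) x').continuousLinearMapAt ℝ q
      ((trivializationAt E (TangentSpace 𝓘(ℝ, E)) x).symmL ℝ q v) = _
  rw [TangentBundle.continuousLinearMapAt_trivializationAt_eq_core hq',
    TangentBundle.symmL_trivializationAt_eq_core hq]
  exact tangentCoordChange_comp (by simp [hq, hq'])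

theorem hasFDerivAt_transition {x x' q : M} (hq : q ∈ (chartAt E x).source)
    (hq' : q ∈ (chartAt E x').source) :
    HasFDerivAt (extChartAt 𝓘(ℝ, E) x' ∘ (extChartAt 𝓘(ℝ, E) x).symm)
      (tangentCoordChange 𝓘(ℝ, E) x x' q) (extChartAt 𝓘(ℝ, E) x q) := by
  rw [← hasFDerivWithinAt_univ]
  simpa using hasFDerivWithinAt_tangentCoordChange (I := 𝓘(ℝ, E)) (x := x) (y := x') (z := q)
    (by simp [hq, hq'])

theorem contDiffAt_transition {x x' q : M} (hq : q ∈ (chartAt E x).source)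
    (hq' : q ∈ (chartAt E x').source) :
    ContDiffAt ℝ ∞ (extChartAt 𝓘(ℝ, E) x' ∘ (extChartAt 𝓘(ℝ, E) x).symm)
      (extChartAt 𝓘(ℝ, E) x q) := by
  have h := contDiffWithinAt_ext_coord_change (I := 𝓘(ℝ, E)) (n := ∞) x' x
    (y := extChartAt 𝓘(ℝ, E) x q) (by simp [hq, hq'])
  simpa [contDiffWithinAt_univ] using h

variable [FiniteDimensional ℝ E]

/-- The basis of `⋀ E` used in the definition of the Schouten bracket. -/
noncomputable def extBasis (E : Type*) [NormedAddCommGroup E] [NormedSpace ℝ E]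
    [FiniteDimensional ℝ E] :
    Module.Basis (Finset (Fin (Module.finrank ℝ E))) ℝ (ExteriorAlgebra ℝ E) :=
  (Module.finBasis ℝ E).ExteriorAlgebra

/-- The coefficients are polynomial in those of the tangent coordinate change. The induction keeps
`a` arbitrary because the product case needs smoothness of all basis coordinates of both factors. -/
theorem contMDiffOn_map_dTransition (x x' : M) (a : Module.Dual ℝ (ExteriorAlgebra ℝ E))
    (c : ExteriorAlgebra ℝ E) :
    ContMDiffOn 𝓘(ℝ, E) 𝓘(ℝ, ℝ) ∞ (fun q => a (ExteriorAlgebra.map (dTransition x x' q) c))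
      ((chartAt E x).source ∩ (chartAt E x').source) := by
  induction c using ExteriorAlgebra.induction generalizing a with
  | algebraMap r => simpa using contMDiffOn_const
  | ι v =>
    simp only [ExteriorAlgebra.map_apply_ι]
    exact (a ∘ₗ ExteriorAlgebra.ι ℝ).toContinuousLinearMap.contMDiff.comp_contMDiffOn
      (contMDiffOn_dTransition x x' v)
  | mul c d hc hd =>
    have h : ∀ q : M, a (ExteriorAlgebra.map (dTransition x x' q) (c * d)) =
        ∑ s, ∑ t, a (extBasis E s * extBasis E t) *
          ((extBasis E).coord s (ExteriorAlgebra.map (dTransition x x' q) c) *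
            (extBasis E).coord t (ExteriorAlgebra.map (dTransition x x' q) d)) := by
      intro q
      rw [map_mul]
      conv_lhs => rw [← (extBasis E).sum_repr (ExteriorAlgebra.map (dTransition x x' q) c),
        ← (extBasis E).sum_repr (ExteriorAlgebra.map (dTransition x x' q) d)]
      simp only [Finset.sum_mul_sum, map_sum, smul_mul_smul_comm, map_smul, smul_eq_mul,
        Module.Basis.coord_apply]
      exact Finset.sum_congr rfl fun s _ => Finset.sum_congr rfl fun t _ => mul_comm _ _
    simp only [h]
    exact contMDiffOn_finsetSum fun s _ => contMDiffOn_finsetSum fun t _ =>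
      contMDiffOn_const.mul ((hc _).mul (hd _))
  | add c d hc hd =>
    simp only [map_add]
    exact (hc a).add (hd a)

end Charts

/-! ### Chart independence, smoothness and Leibniz rule of the exterior derivative. -/

section ExteriorDerivative

open Set Filter Topology

variable {E : Type*} [NormedAddCommGroup E] [NormedSpace ℝ E]
  {M : Type*} [TopologicalSpace M] [ChartedSpace E M] [IsManifold 𝓘(ℝ, E) ∞ M]

/-- The values of a form on the constant-coefficient multivector field `c` of the chart around
`x`, as a function on the image of the chart. -/
noncomputable def RawForm.coeff (β : RawForm E M) (x : M) (c : ExteriorAlgebra ℝ E) (y : E) : ℝ :=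
  β ((extChartAt 𝓘(ℝ, E) x).symm y)
    (ExteriorAlgebra.map (dChartSymm E M x ((extChartAt 𝓘(ℝ, E) x).symm y)) c)

theorem RawForm.coeff_extChartAt (β : RawForm E M) {x q : M} (hq : q ∈ (chartAt E x).source)
    (c : ExteriorAlgebra ℝ E) : β.coeff x c (extChartAt 𝓘(ℝ, E) x q) =
      β q (ExteriorAlgebra.map (dChartSymm E M x q) c) := by
  have h := (extChartAt 𝓘(ℝ, E) x).left_inv (x := q) (by simpa using hq)
  rw [RawForm.coeff, h]

theorem RawForm.IsSmooth.contDiffOn_coeff {β : RawForm E M} (hβ : β.IsSmooth) (x : M)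
    (c : ExteriorAlgebra ℝ E) :
    ContDiffOn ℝ ∞ (β.coeff x c) (extChartAt 𝓘(ℝ, E) x).target := by
  rw [← contMDiffOn_iff_contDiffOn]
  exact (hβ x c).comp (contMDiffOn_extChartAt_symm x) fun y hy => by
    simpa using (extChartAt 𝓘(ℝ, E) x).map_target hy

theorem RawForm.IsSmooth.differentiableAt_coeff {β : RawForm E M} (hβ : β.IsSmooth) {x q : M}
    (hq : q ∈ (chartAt E x).source) (c : ExteriorAlgebra ℝ E) :
    DifferentiableAt ℝ (β.coeff x c) (extChartAt 𝓘(ℝ, E) x q) :=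
  ((hβ.contDiffOn_coeff x c).contDiffAt ((isOpen_extChartAt_target x).mem_nhds
    ((extChartAt 𝓘(ℝ, E) x).map_source (by simpa using hq)))).differentiableAt (by simp)

theorem differentiableAt_comp_extChartAt_symm (f : C^∞⟮𝓘(ℝ, E), M; ℝ⟯) (p : M) :
    DifferentiableAt ℝ (f ∘ (extChartAt 𝓘(ℝ, E) p).symm) (extChartAt 𝓘(ℝ, E) p p) := by
  have h : ContMDiffAt 𝓘(ℝ, E) 𝓘(ℝ, ℝ) ∞ (f ∘ (extChartAt 𝓘(ℝ, E) p).symm)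
      (extChartAt 𝓘(ℝ, E) p p) :=
    f.contMDiff.contMDiffAt.comp _ ((contMDiffOn_extChartAt_symm p).contMDiffAt
      ((isOpen_extChartAt_target p).mem_nhds (mem_extChartAt_target p)))
  exact h.contDiffAt.differentiableAt (by simp)

variable [FiniteDimensional ℝ E]

/-- Separates the dependence on the point, carried by scalar coefficients, from constant alternating
forms; differentiation then concerns only the scalars. -/
theorem RawForm.inChart_eq_sum (β : RawForm E M) (x : M) (j : ℕ) (y : E) :
    β.inChart x j y = ∑ s, β.coeff x (extBasis E s) y •
      toContAlt (altOfDual ((extBasis E).coord s) j) := by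
  ext v
  have h : β.inChart x j y v = β ((extChartAt 𝓘(ℝ, E) x).symm y)
      (ExteriorAlgebra.map (dChartSymm E M x ((extChartAt 𝓘(ℝ, E) x).symm y))
        (ExteriorAlgebra.ιMulti ℝ j v)) := by
    rw [ExteriorAlgebra.map_apply_ιMulti]
    rfl
  rw [h, ← (extBasis E).sum_repr (ExteriorAlgebra.ιMulti ℝ j v)]
  simp only [map_sum, map_smul, smul_eq_mul, ContinuousAlternatingMap.sum_apply,
    ContinuousAlternatingMap.smul_apply]
  exact Finset.sum_congr rfl fun s _ => mul_comm _ _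

theorem RawForm.IsSmooth.differentiableAt_inChart {β : RawForm E M} (hβ : β.IsSmooth) {x q : M}
    (hq : q ∈ (chartAt E x).source) (j : ℕ) :
    DifferentiableAt ℝ (β.inChart x j) (extChartAt 𝓘(ℝ, E) x q) := by
  rw [funext (β.inChart_eq_sum x j)]
  exact DifferentiableAt.fun_sum fun s _ => (hβ.differentiableAt_coeff hq _).smul_const _

/-- The chart expressions are pullbacks of each other under the transition map. Equality of germs,
rather than at one point, is what taking `d` requires. -/
theorem RawForm.inChart_eventuallyEq (β : RawForm E M) {x x' q : M}
    (hq : q ∈ (chartAt E x).source) (hq' : q ∈ (chartAt E x').source) (j : ℕ) :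
    β.inChart x j =ᶠ[𝓝 (extChartAt 𝓘(ℝ, E) x q)] fun y =>
      (β.inChart x' j ((extChartAt 𝓘(ℝ, E) x' ∘ (extChartAt 𝓘(ℝ, E) x).symm) y)
        ).compContinuousLinearMap
        (fderiv ℝ (extChartAt 𝓘(ℝ, E) x' ∘ (extChartAt 𝓘(ℝ, E) x).symm) y) := by
  have hqs : q ∈ (extChartAt 𝓘(ℝ, E) x).source := by simpa using hq
  have hev : ∀ᶠ y in 𝓝 (extChartAt 𝓘(ℝ, E) x q),
      (extChartAt 𝓘(ℝ, E) x).symm y ∈ (chartAt E x').source := by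
    refine (continuousAt_extChartAt_symm'' ((extChartAt 𝓘(ℝ, E) x).map_source hqs)
      ).eventually_mem ?_
    rw [(extChartAt 𝓘(ℝ, E) x).left_inv hqs]
    exact (chartAt E x').open_source.mem_nhds hq'
  filter_upwards [hev, (isOpen_extChartAt_target x).mem_nhds
    ((extChartAt 𝓘(ℝ, E) x).map_source hqs)] with y hy' hy
  obtain ⟨p, hp, rfl⟩ : ∃ p ∈ (chartAt E x).source, extChartAt 𝓘(ℝ, E) x p = y :=
    ⟨_, by simpa using (extChartAt 𝓘(ℝ, E) x).map_target hy,
      (extChartAt 𝓘(ℝ, E) x).right_inv hy⟩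
  have hpx := (extChartAt 𝓘(ℝ, E) x).left_inv (x := p) (by simpa using hp)
  rw [hpx] at hy'
  have hpx' := (extChartAt 𝓘(ℝ, E) x').left_inv (x := p) (by simpa using hy')
  rw [(hasFDerivAt_transition hp hy').fderiv, Function.comp_apply, hpx]
  ext v
  change altOfDual (β ((extChartAt 𝓘(ℝ, E) x).symm (extChartAt 𝓘(ℝ, E) x p))) j
      (fun i => dChartSymm E M x ((extChartAt 𝓘(ℝ, E) x).symm (extChartAt 𝓘(ℝ, E) x p)) (v i)) =
    altOfDual (β ((extChartAt 𝓘(ℝ, E) x').symm (extChartAt 𝓘(ℝ, E) x' p))) j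
      (fun i => dChartSymm E M x' ((extChartAt 𝓘(ℝ, E) x').symm (extChartAt 𝓘(ℝ, E) x' p))
        ((tangentCoordChange 𝓘(ℝ, E) x x' p).toLinearMap (v i)))
  rw [hpx, hpx', ← dTransition_eq_tangentCoordChange hp hy']
  congr 1
  funext i
  exact (dChartSymm_dChart hy' _).symm

/-- The exterior derivative may be computed in any chart. -/
theorem extD_apply_ιMulti {β : RawForm E M} (hβ : β.IsSmooth) {x q : M}
    (hq : q ∈ (chartAt E x).source) {j : ℕ} (v : Fin (j + 1) → TangentSpace 𝓘(ℝ, E) q) :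
    extD β q (ExteriorAlgebra.ιMulti ℝ (j + 1) v) =
      extDeriv (β.inChart x j) (extChartAt 𝓘(ℝ, E) x q) (fun i => dChart E M x q (v i)) := by
  have hqq := mem_chart_source E q
  rw [extD, ExteriorAlgebra.liftAlternating_apply_ιMulti]
  change extDeriv (β.inChart q j) (extChartAt 𝓘(ℝ, E) q q) (fun i => dChart E M q q (v i)) = _
  have h := (extChartAt 𝓘(ℝ, E) q).left_inv (x := q) (by simp)
  -- The definition uses the chart centred at `q`; naturality of `d` under pullback by the
  -- transition map moves the computation to the chart around `x`.
  rw [(β.inChart_eventuallyEq hqq hq j).extDeriv_eq,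
    extDeriv_pullback (r := ∞) _ (contDiffAt_transition hqq hq)
      (by rw [minSmoothness_of_isRCLikeNormedField]; exact WithTop.coe_le_coe.2 le_top),
    (hasFDerivAt_transition hqq hq).fderiv, Function.comp_apply, h]
  · change extDeriv (β.inChart x j) (extChartAt 𝓘(ℝ, E) x q)
      (fun i => (tangentCoordChange 𝓘(ℝ, E) q x q).toLinearMap (dChart E M q q (v i))) = _
    rw [← dTransition_eq_tangentCoordChange hqq hq]
    congr 1
    funext i
    change dChart E M x q (dChartSymm E M q q (dChart E M q q (v i))) = _
    rw [dChartSymm_dChart hqq]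
  · rw [Function.comp_apply, h]
    exact hβ.differentiableAt_inChart hq j

/-- The exterior derivative in the chart around `x`: if `β = ∑ₛ gₛ eˢ` for the dual basis `eˢ` of
`⋀ E`, then `dβ = ∑ₛ dgₛ ∧ eˢ`. -/
theorem extD_apply {β : RawForm E M} (hβ : β.IsSmooth) {x q : M}
    (hq : q ∈ (chartAt E x).source) (z : ExteriorAlgebra ℝ (TangentSpace 𝓘(ℝ, E) q)) :
    extD β q z = ∑ s, (extBasis E).coord s
      (contractL (fderiv ℝ (β.coeff x (extBasis E s)) (extChartAt 𝓘(ℝ, E) x q)).toLinearMap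
        (ExteriorAlgebra.map (dChart E M x q) z)) := by
  suffices h : extD β q = ∑ s, (extBasis E).coord s ∘ₗ
      contractLₗ (fderiv ℝ (β.coeff x (extBasis E s)) (extChartAt 𝓘(ℝ, E) x q)).toLinearMap ∘ₗ
        (ExteriorAlgebra.map (dChart E M x q)).toLinearMap by
    rw [h, LinearMap.sum_apply]
    rfl
  refine ExteriorAlgebra.lhom_ext fun j => ?_
  ext v
  simp only [LinearMap.compAlternatingMap_apply, LinearMap.sum_apply, LinearMap.comp_apply,
    AlgHom.toLinearMap_apply, contractLₗ_apply]
  cases j with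
  | zero =>
    simp only [ExteriorAlgebra.ιMulti_zero_apply, map_one, contractL_one, map_zero,
      Finset.sum_const_zero, extD, ExteriorAlgebra.liftAlternating_one]
    rfl
  | succ j =>
    rw [extD_apply_ιMulti hβ hq, extDeriv, funext (β.inChart_eq_sum x j),
      fderiv_fun_sum (A := fun s y => β.coeff x (extBasis E s) y •
        toContAlt (altOfDual ((extBasis E).coord s) j)) fun s _ =>
        (hβ.differentiableAt_coeff hq _).smul_const _,
      ContinuousAlternatingMap.alternatizeUncurryFin_apply]
    simp only [ExteriorAlgebra.map_apply_ιMulti, ← sum_altOfDual_removeNth]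
    rw [Finset.sum_comm]
    refine Finset.sum_congr rfl fun i _ => ?_
    rw [sum_apply, ContinuousAlternatingMap.sum_apply, Finset.smul_sum]
    refine Finset.sum_congr rfl fun s _ => ?_
    rw [fderiv_smul_const (hβ.differentiableAt_coeff hq (extBasis E s))
      (toContAlt (altOfDual ((extBasis E).coord s) j)), ContinuousLinearMap.smulRight_apply,
      ContinuousAlternatingMap.smul_apply, smul_eq_mul, zsmul_eq_mul]
    push_cast
    rfl

/-- The contraction with `λ`, as a linear combination of contractions with coordinates. -/
theorem contractL_eq_sum (α : Module.Dual ℝ E) (x : ExteriorAlgebra ℝ E) :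
    contractL α x = ∑ i, α (Module.finBasis ℝ E i) •
      contractL ((Module.finBasis ℝ E).coord i) x := by
  have h : α = ∑ i, α (Module.finBasis ℝ E i) • (Module.finBasis ℝ E).coord i := by
    simp
  conv_lhs => rw [← contractLₗ_apply, h]
  simp only [map_sum, map_smul, LinearMap.sum_apply, LinearMap.smul_apply, contractLₗ_apply]

/-- In a fixed chart the value is a finite sum of partial derivatives of coefficients of `β` times
components of contractions of `X`, each smooth on the chart domain. -/
theorem contMDiff_extD_apply {β : RawForm E M} (hβ : β.IsSmooth) {X : RawMVF E M}
    (hX : X.IsSmooth) : ContMDiff 𝓘(ℝ, E) 𝓘(ℝ, ℝ) ∞ fun p => extD β p (X p) := by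
  intro x
  suffices h : ContMDiffOn 𝓘(ℝ, E) 𝓘(ℝ, ℝ) ∞ (fun p => extD β p (X p)) (chartAt E x).source from
    h.contMDiffAt ((chartAt E x).open_source.mem_nhds (mem_chart_source E x))
  refine ContMDiffOn.congr ?_ fun p hp => extD_apply hβ hp (X p)
  refine contMDiffOn_finsetSum fun s _ => ?_
  simp only [contractL_eq_sum (_ : E →L[ℝ] ℝ).toLinearMap, map_sum, map_smul, smul_eq_mul]
  refine contMDiffOn_finsetSum fun i _ => ContMDiffOn.mul ?_
    (hX x ((extBasis E).coord s ∘ₗ contractLₗ ((Module.finBasis ℝ E).coord i)))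
  have h := (hβ.contDiffOn_coeff x (extBasis E s)).fderiv_of_isOpen (m := ∞)
    (isOpen_extChartAt_target x) (by simp)
  exact (h.clm_apply contDiffOn_const).contMDiffOn.comp (contMDiffOn_extChartAt (n := ∞))
    fun p hp => (extChartAt 𝓘(ℝ, E) x).map_source (by simpa using hp)

theorem extD_add {β β' : RawForm E M} (hβ : β.IsSmooth) (hβ' : β'.IsSmooth) :
    extD (β + β') = extD β + extD β' := by
  funext p
  refine LinearMap.ext fun z => ?_
  have hp := mem_chart_source E p
  have hs : (β + β').IsSmooth := (DForm E M).add_mem hβ hβ'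
  rw [Pi.add_apply, LinearMap.add_apply, extD_apply hs hp, extD_apply hβ hp, extD_apply hβ' hp,
    ← Finset.sum_add_distrib]
  refine Finset.sum_congr rfl fun s _ => ?_
  have h : (β + β').coeff p (extBasis E s) =
    β.coeff p (extBasis E s) + β'.coeff p (extBasis E s) := rfl
  rw [h, fderiv_add (hβ.differentiableAt_coeff hp _) (hβ'.differentiableAt_coeff hp _), ← map_add]
  simp only [← contractLₗ_apply, ← LinearMap.add_apply, ← map_add]
  rfl

/-- `d(f β) = df ∧ β + f dβ`. -/
theorem extD_smul {β : RawForm E M} (hβ : β.IsSmooth) (f : C^∞⟮𝓘(ℝ, E), M; ℝ⟯) (p : M)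
    (z : ExteriorAlgebra ℝ (TangentSpace 𝓘(ℝ, E) p)) :
    extD (fun q => f q • β q) p z = f p * extD β p z +
      β p (ExteriorAlgebra.map (dChartSymm E M p p)
        (contractL (fderiv ℝ (f ∘ (extChartAt 𝓘(ℝ, E) p).symm)
          (extChartAt 𝓘(ℝ, E) p p)).toLinearMap (ExteriorAlgebra.map (dChart E M p p) z))) := by
  have hp := mem_chart_source E p
  have hpp := (extChartAt 𝓘(ℝ, E) p).left_inv (x := p) (by simp)
  have hs : RawForm.IsSmooth (fun q => f q • β q) := fun x c =>
    f.contMDiff.contMDiffOn.mul (hβ x c)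
  have hf := differentiableAt_comp_extChartAt_symm f p
  set w := ExteriorAlgebra.map (dChart E M p p) z with hw
  set df := fderiv ℝ (f ∘ (extChartAt 𝓘(ℝ, E) p).symm) (extChartAt 𝓘(ℝ, E) p p) with hdf
  have hlast : β p (ExteriorAlgebra.map (dChartSymm E M p p) (contractL df.toLinearMap w)) =
      ∑ s, β.coeff p (extBasis E s) (extChartAt 𝓘(ℝ, E) p p) *
        (extBasis E).coord s (contractL df.toLinearMap w) := by
    conv_lhs => rw [← (extBasis E).sum_repr (contractL df.toLinearMap w)]
    simp only [map_sum, map_smul, smul_eq_mul, RawForm.coeff_extChartAt β hp]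
    exact Finset.sum_congr rfl fun s _ => mul_comm _ _
  rw [extD_apply hs hp, extD_apply hβ hp, ← hw, hlast, Finset.mul_sum, ← Finset.sum_add_distrib]
  refine Finset.sum_congr rfl fun s _ => ?_
  have h : RawForm.coeff (fun q => f q • β q) p (extBasis E s) =
    fun y => (f ∘ (extChartAt 𝓘(ℝ, E) p).symm) y * β.coeff p (extBasis E s) y := rfl
  rw [h, fderiv_fun_mul hf (hβ.differentiableAt_coeff hp _), ← hdf, Function.comp_apply, hpp,
    ← contractLₗ_apply]
  change (extBasis E).coord s (contractLₗ
    (f p • (fderiv ℝ (β.coeff p (extBasis E s)) (extChartAt 𝓘(ℝ, E) p p)).toLinearMap +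
      β.coeff p (extBasis E s) (extChartAt 𝓘(ℝ, E) p p) • df.toLinearMap) w) = _
  simp only [map_add, map_smul, LinearMap.add_apply, LinearMap.smul_apply, smul_eq_mul,
    contractLₗ_apply]

end ExteriorDerivative

/-! ### The bracket with a function and the cancellation giving function-linearity. -/

section Connection

open Set Filter Topology

variable {E : Type*} [NormedAddCommGroup E] [NormedSpace ℝ E] [FiniteDimensional ℝ E]
  {M : Type*} [TopologicalSpace M] [ChartedSpace E M] [IsManifold 𝓘(ℝ, E) ∞ M]

theorem RawForm.IsSmooth.interior {β : RawForm E M} (hβ : β.IsSmooth) {Y : RawMVF E M}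
    (hY : Y.IsSmooth) : (interior Y β).IsSmooth := by
  intro x c
  have h : ∀ p ∈ (chartAt E x).source,
      HigherConn.interior Y β p (ExteriorAlgebra.map (dChartSymm E M x p) c) =
        ∑ s, (extBasis E).coord s (ExteriorAlgebra.map (dChart E M x p) (Y p)) *
          β p (ExteriorAlgebra.map (dChartSymm E M x p) (extBasis E s * c)) := by
    intro p hp
    change β p (Y p * _) = _
    conv_lhs => rw [← map_dChartSymm_map_dChart hp (Y p),
      ← (extBasis E).sum_repr (ExteriorAlgebra.map (dChart E M x p) (Y p)), ← map_mul]
    simp only [Finset.sum_mul, map_sum, smul_mul_assoc, map_smul, smul_eq_mul,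
      Module.Basis.coord_apply]
  exact (contMDiffOn_finsetSum fun s _ => (hY x _).mul (hβ x _)).congr h

theorem RawForm.IsSmooth.contMDiff_apply {β : RawForm E M} (hβ : β.IsSmooth) {Y : RawMVF E M}
    (hY : Y.IsSmooth) : ContMDiff 𝓘(ℝ, E) 𝓘(ℝ, ℝ) ∞ fun p => β p (Y p) := by
  intro x
  have h := hβ.interior hY x 1
  simp only [map_one, HigherConn.interior, LinearMap.comp_apply, LinearMap.mulLeft_apply,
    mul_one] at h
  exact h.contMDiffAt ((chartAt E x).open_source.mem_nhds (mem_chart_source E x))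

theorem extAlgDeriv_algebraMap {g : E → ℝ} {y : E} (hg : DifferentiableAt ℝ g y) (v : E) :
    extAlgDeriv (fun z => algebraMap ℝ (ExteriorAlgebra ℝ E) (g z)) y v =
      algebraMap ℝ _ (fderiv ℝ g y v) := by
  have h : ∀ s : Finset (Fin (Module.finrank ℝ E)),
      fderiv ℝ (fun z => (Module.finBasis ℝ E).ExteriorAlgebra.coord s
        (algebraMap ℝ (ExteriorAlgebra ℝ E) (g z))) y v =
      fderiv ℝ g y v * (Module.finBasis ℝ E).ExteriorAlgebra.repr 1 s := by
    intro s
    have h' : (fun z => (Module.finBasis ℝ E).ExteriorAlgebra.coord s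
        (algebraMap ℝ (ExteriorAlgebra ℝ E) (g z))) =
        fun z => g z * (Module.finBasis ℝ E).ExteriorAlgebra.repr 1 s := by
      funext z
      rw [Algebra.algebraMap_eq_smul_one, map_smul, smul_eq_mul, Module.Basis.coord_apply]
    rw [h', fderiv_mul_const hg]
    simp [mul_comm]
  simp only [extAlgDeriv, h, mul_smul]
  rw [← Finset.smul_sum, Module.Basis.sum_repr, Algebra.algebraMap_eq_smul_one]

/-- Collapses the coordinate sum in the Schouten bracket with a function into a single contraction
by its differential. -/
theorem contractR_eq_sum (x : ExteriorAlgebra ℝ E) (α : Module.Dual ℝ E) :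
    contractR x α = ∑ i, α (Module.finBasis ℝ E i) •
      contractR x ((Module.finBasis ℝ E).coord i) := by
  have h : α = ∑ i, α (Module.finBasis ℝ E i) • (Module.finBasis ℝ E).coord i := by
    simp
  conv_lhs => rw [← contractRₗ_apply, h]
  simp only [map_sum, map_smul, contractRₗ_apply]

/-- `[X, f] = X ⌊ df` for functions `f`. -/
theorem schouten_funMVF (X : RawMVF E M) (f : C^∞⟮𝓘(ℝ, E), M; ℝ⟯) (p : M) :
    schouten X (funMVF f).1 p = ExteriorAlgebra.map (dChartSymm E M p p)
      (contractR (ExteriorAlgebra.map (dChart E M p p) (X p))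
        (fderiv ℝ (f ∘ (extChartAt 𝓘(ℝ, E) p).symm) (extChartAt 𝓘(ℝ, E) p p)).toLinearMap) := by
  have hpp := (extChartAt 𝓘(ℝ, E) p).left_inv (x := p) (by simp)
  have hX : X.inChart p (extChartAt 𝓘(ℝ, E) p p) =
      ExteriorAlgebra.map (dChart E M p p) (X p) := by
    rw [RawMVF.inChart, hpp]
  have hf : (funMVF f).1.inChart p = fun y => algebraMap ℝ (ExteriorAlgebra ℝ E)
      ((f ∘ (extChartAt 𝓘(ℝ, E) p).symm) y) := by
    funext y
    exact AlgHom.commutes _ _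
  rw [schouten, schoutenE, hX, hf, contractR_eq_sum]
  congr 1
  refine Finset.sum_congr rfl fun i _ => ?_
  rw [extAlgDeriv_algebraMap (differentiableAt_comp_extChartAt_symm f p), contractL_algebraMap,
    mul_zero, sub_zero, Algebra.algebraMap_eq_smul_one, mul_smul_comm, mul_one]
  rfl

/-- Only the `i_X d` half of the Lie derivative survives evaluation at `1`, because the degree `0`
part of any exterior derivative is zero. -/
theorem HigherConnection.covForm_apply (C : HigherConnection E M) (k l : ℤ) (X : MVF E M)
    (α : DForm E M) (Y : MVF E M) (p : M) :
    C.covForm k l X α Y p =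
      (-1 : ℝ) ^ ((k - 1) * (l - 1)) * (-(-1 : ℝ) ^ k * extD (interior Y.1 α.1) p (X.1 p)) -
        α.1 p ((C.nabla X Y).1 p) := by
  have h : extD (interior X.1 (interior Y.1 α.1)) p 1 = 0 := by
    rw [extD, ExteriorAlgebra.liftAlternating_one]
    rfl
  rw [covForm, lieD, Pi.sub_apply, LinearMap.sub_apply, h, zero_sub, Pi.smul_apply,
    LinearMap.smul_apply, smul_eq_mul, neg_mul]
  simp only [interior, LinearMap.comp_apply, LinearMap.mulLeft_apply, mul_one]

theorem HigherConnection.covForm_add (C : HigherConnection E M) (k l : ℤ) (X : MVF E M)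
    (α : DForm E M) (Y Y' : MVF E M) :
    C.covForm k l X α (Y + Y') = C.covForm k l X α Y + C.covForm k l X α Y' := by
  funext p
  have h : interior (Y + Y').1 α.1 = interior Y.1 α.1 + interior Y'.1 α.1 := by
    funext q
    refine LinearMap.ext fun z => ?_
    change α.1 q ((Y.1 q + Y'.1 q) * z) = α.1 q (Y.1 q * z) + α.1 q (Y'.1 q * z)
    rw [add_mul, map_add]
  have h' : (C.nabla X Y + C.nabla X Y').1 p = (C.nabla X Y).1 p + (C.nabla X Y').1 p := rfl
  rw [Pi.add_apply, covForm_apply, covForm_apply, covForm_apply, h,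
    extD_add (RawForm.IsSmooth.interior α.2 Y.2) (RawForm.IsSmooth.interior α.2 Y'.2),
    Pi.add_apply, LinearMap.add_apply, C.add_right, h', map_add]
  ring

/-- `α ([X, f] ∧ Y) = ± (df ∧ i_Y α)(X)`. -/
theorem apply_schouten_mul {k m : ℤ} (hk : 0 < k) {X : MVF E M} (hX : X ∈ MVF.ofDegree E M k)
    (α : DForm E M) (f : C^∞⟮𝓘(ℝ, E), M; ℝ⟯) {Y : MVF E M} (hY : Y ∈ MVF.ofDegree E M m) (p : M) :
    α.1 p (schouten X.1 (funMVF f).1 p * Y.1 p) = (-1 : ℝ) ^ ((k - 1) * (m + 1)) *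
      interior Y.1 α.1 p (ExteriorAlgebra.map (dChartSymm E M p p)
        (contractL (fderiv ℝ (f ∘ (extChartAt 𝓘(ℝ, E) p).symm)
          (extChartAt 𝓘(ℝ, E) p p)).toLinearMap
            (ExteriorAlgebra.map (dChart E M p p) (X.1 p)))) := by
  -- Positivity of `k` makes the degree `j = k - 1` of the contracted field a natural number.
  obtain ⟨j, rfl⟩ : ∃ j : ℕ, k = ((j + 1 : ℕ) : ℤ) := ⟨(k - 1).toNat, by omega⟩
  have hYp := hY p
  change _ = _ * α.1 p (Y.1 p * _)
  cases m with
  | negSucc n =>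
    have h0 : Y.1 p = 0 := hYp
    rw [h0, zero_mul, mul_zero, map_zero, mul_zero]
  | ofNat n =>
    have hXp : ExteriorAlgebra.map (dChart E M p p) (X.1 p) ∈ ⋀[ℝ]^(j + 1) E :=
      map_mem_exteriorPower _ (hX p)
    set df := (fderiv ℝ (f ∘ (extChartAt 𝓘(ℝ, E) p).symm)
          (extChartAt 𝓘(ℝ, E) p p)).toLinearMap with hdf
    have hR : contractR (ExteriorAlgebra.map (dChart E M p p) (X.1 p)) df =
        (-1 : ℝ) ^ j • contractL df (ExteriorAlgebra.map (dChart E M p p) (X.1 p)) := by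
      rw [contractL_eq_contractR df hXp, smul_smul, ← pow_add,
        Even.neg_one_pow ⟨j + 1, by ring⟩, one_smul]
    rw [schouten_funMVF, ← hdf, hR, map_smul, smul_mul_assoc,
      mul_comm_of_mem_exteriorPower (m := j) (n := n)
        (map_mem_exteriorPower _ (contractL_mem_exteriorPower df hXp)) hYp, smul_smul, map_smul,
      smul_eq_mul, ← pow_add]
    congr 1
    rw [← zpow_natCast]
    congr 1
    push_cast
    change _ = _ * ((n : ℤ) + 1)
    ring

/-- The `df` term from `d(f i_Y α)` and the bracket term from the Leibniz rule are the same pairing,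
and their coefficients cancel. -/
theorem HigherConnection.covForm_smul (C : HigherConnection E M) {k l : ℤ} (hk : 0 < k)
    {X : MVF E M} (hX : X ∈ MVF.ofDegree E M k) (α : DForm E M) (f : C^∞⟮𝓘(ℝ, E), M; ℝ⟯)
    {Y : MVF E M} (hY : Y ∈ MVF.ofDegree E M (l - k + 1)) :
    C.covForm k l X α (f • Y) = fun p => f p * C.covForm k l X α Y p := by
  funext p
  have h : interior (f • Y).1 α.1 = fun q => f q • interior Y.1 α.1 q := by
    funext q
    refine LinearMap.ext fun z => ?_
    change α.1 q ((f q • Y.1 q) * z) = f q • α.1 q (Y.1 q * z)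
    rw [smul_mul_assoc, map_smul]
  -- The sign from `apply_schouten_mul` at degree `m = l - k + 1` equals the coefficient of `d i_Y
  -- α` in `covForm_apply`. The exponents on the two sides, together with the `1` for the minus
  -- sign, sum to an even number because `(k - 1) * k` is even.
  have hs : (-1 : ℝ) ^ ((k - 1) * (l - k + 1 + 1)) =
      -((-1 : ℝ) ^ ((k - 1) * (l - 1)) * (-1) ^ k) := by
    have h1 : (-1 : ℝ) ≠ 0 := by norm_num
    have h2 : ∀ a b c : ℤ, Even (a + b + c + 1) → (-1 : ℝ) ^ a = -((-1 : ℝ) ^ b * (-1) ^ c) := by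
      intro a b c habc
      have h3 := habc.neg_one_zpow (α := ℝ)
      rw [zpow_add₀ h1, zpow_add₀ h1, zpow_add₀ h1, zpow_one] at h3
      have h4 : ∀ d : ℤ, (-1 : ℝ) ^ d * (-1) ^ d = 1 := fun d => by rw [← mul_zpow]; norm_num
      linear_combination (-((-1) ^ b * (-1) ^ c)) * h3 - (-1) ^ a * (-1) ^ c * (-1) ^ c * h4 b -
        (-1) ^ a * h4 c
    refine h2 _ _ _ ?_
    have h4 : (k - 1) * (l - k + 1 + 1) + (k - 1) * (l - 1) + k + 1 =
        2 * ((k - 1) * l + k) - (k - 1) * (k - 1 + 1) := by ring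
    rw [h4]
    exact (even_two_mul _).sub (Int.even_mul_succ_self (k - 1))
  rw [covForm_apply, covForm_apply, h, extD_smul (RawForm.IsSmooth.interior α.2 Y.2),
    C.leibniz hX, map_add, apply_schouten_mul hk hX α f hY, hs, map_smul, smul_eq_mul]
  ring

theorem HigherConnection.contMDiff_covForm (C : HigherConnection E M) (k l : ℤ)
    (X : MVF E M) (α : DForm E M) (Y : MVF E M) :
    ContMDiff 𝓘(ℝ, E) 𝓘(ℝ, ℝ) ∞ (C.covForm k l X α Y) := by
  rw [funext (C.covForm_apply k l X α Y)]
  exact (contMDiff_const.mul (contMDiff_const.mul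
    (contMDiff_extD_apply (RawForm.IsSmooth.interior α.2 Y.2) X.2))).sub
      (RawForm.IsSmooth.contMDiff_apply α.2 (C.nabla X Y).2)

end Connection

/-! ### Global fields and functions from cut-off local frames. -/

section Extension

open Set Filter Topology

variable {E : Type*} [NormedAddCommGroup E] [NormedSpace ℝ E]
  {M : Type*} [TopologicalSpace M] [ChartedSpace E M] [IsManifold 𝓘(ℝ, E) ∞ M]

/-- The component `χ Yₛ` in the chart around `x`, cut off by a function `χ` supported in the domain
of this chart. -/
noncomputable def cutoffCoord (x : M) (χ : C^∞⟮𝓘(ℝ, E), M; ℝ⟯)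
    (hχ : tsupport χ ⊆ (chartAt E x).source) (a : Module.Dual ℝ (ExteriorAlgebra ℝ E))
    (Y : MVF E M) : C^∞⟮𝓘(ℝ, E), M; ℝ⟯ :=
  ⟨fun q => χ q * a (ExteriorAlgebra.map (dChart E M x q) (Y.1 q)), fun q => by
    by_cases hqx : q ∈ tsupport χ
    · exact χ.contMDiff.contMDiffAt.mul ((Y.2 x a).contMDiffAt
        ((chartAt E x).open_source.mem_nhds (hχ hqx)))
    · have h0 := notMem_tsupport_iff_eventuallyEq.1 hqx
      refine ContMDiffAt.congr_of_eventuallyEq (contMDiffAt_const (c := (0 : ℝ))) ?_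
      filter_upwards [h0] with q' hq'
      rw [hq', Pi.zero_apply, zero_mul]⟩

theorem cutoffCoord_apply (x : M) (χ : C^∞⟮𝓘(ℝ, E), M; ℝ⟯)
    (hχ : tsupport χ ⊆ (chartAt E x).source) (a : Module.Dual ℝ (ExteriorAlgebra ℝ E))
    (Y : MVF E M) (q : M) :
    cutoffCoord x χ hχ a Y q = χ q * a (ExteriorAlgebra.map (dChart E M x q) (Y.1 q)) := rfl

variable [FiniteDimensional ℝ E]

/-- A constant-coefficient multivector field of the chart around `x`, cut off by a function
supported in the domain of this chart. -/
noncomputable def cutoffMVF (x : M) (χ : C^∞⟮𝓘(ℝ, E), M; ℝ⟯)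
    (hχ : tsupport χ ⊆ (chartAt E x).source) (c : ExteriorAlgebra ℝ E) : MVF E M :=
  ⟨fun q => χ q • ExteriorAlgebra.map (dChartSymm E M x q) c, fun x' a => by
    have h : ∀ q, a (ExteriorAlgebra.map (dChart E M x' q)
        (χ q • ExteriorAlgebra.map (dChartSymm E M x q) c)) =
        χ q * a (ExteriorAlgebra.map (dTransition x x' q) c) := by
      intro q
      rw [map_smul, map_smul, smul_eq_mul, ← AlgHom.comp_apply, ExteriorAlgebra.map_comp_map]
      rfl
    simp only [h]
    intro q hq
    by_cases hqx : q ∈ tsupport χ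
    · have hqx' := hχ hqx
      exact (χ.contMDiff.contMDiffAt.mul ((contMDiffOn_map_dTransition x x' a c).contMDiffAt
        (((chartAt E x).open_source.inter (chartAt E x').open_source).mem_nhds
          ⟨hqx', hq⟩))).contMDiffWithinAt
    · have h0 := notMem_tsupport_iff_eventuallyEq.1 hqx
      refine (ContMDiffAt.congr_of_eventuallyEq (contMDiffAt_const (c := (0 : ℝ)))
        ?_).contMDiffWithinAt
      filter_upwards [h0] with q' hq'
      rw [hq', Pi.zero_apply, zero_mul]⟩

theorem cutoffMVF_apply (x : M) (χ : C^∞⟮𝓘(ℝ, E), M; ℝ⟯)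
    (hχ : tsupport χ ⊆ (chartAt E x).source) (c : ExteriorAlgebra ℝ E) (q : M) :
    (cutoffMVF x χ hχ c).1 q = χ q • ExteriorAlgebra.map (dChartSymm E M x q) c := rfl

theorem cutoffMVF_mem {x : M} {χ : C^∞⟮𝓘(ℝ, E), M; ℝ⟯}
    (hχ : tsupport χ ⊆ (chartAt E x).source) {m : ℤ} {c : ExteriorAlgebra ℝ E}
    (hc : c ∈ gradedPart E m) : cutoffMVF x χ hχ c ∈ MVF.ofDegree E M m := fun _ =>
  Submodule.smul_mem _ _ (map_mem_gradedPart _ hc)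

/-- Two factors of `χ` are needed, one to globalize the component functions and one to globalize the
frame fields. Projecting the frame to degree `n` changes nothing, as `Y` is homogeneous, and makes
every summand an `n`-vector field. -/
theorem smul_smul_eq_sum_cutoff {x : M} {χ : C^∞⟮𝓘(ℝ, E), M; ℝ⟯}
    (hχ : tsupport χ ⊆ (chartAt E x).source) {n : ℕ} {Y : MVF E M}
    (hY : Y ∈ MVF.ofDegree E M n) :
    χ • χ • Y = ∑ s, cutoffCoord x χ hχ ((extBasis E).coord s) Y •
      cutoffMVF x χ hχ (degreeProj E n (extBasis E s)) := by
  refine Subtype.ext (funext fun q => ?_)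
  rw [AddSubmonoidClass.coe_finsetSum, Finset.sum_apply]
  change χ q • χ q • Y.1 q = ∑ s, (χ q * _) • (χ q • _)
  by_cases hqx : q ∈ tsupport χ
  · have hq := hχ hqx
    have h : ∀ (r : ℝ) (c : ExteriorAlgebra ℝ E), (χ q * r) •
        (χ q • ExteriorAlgebra.map (dChartSymm E M x q) (degreeProj E n c)) =
        χ q • χ q • ExteriorAlgebra.map (dChartSymm E M x q) (degreeProj E n (r • c)) := by
      intro r c
      rw [mul_smul, smul_comm r (χ q), map_smul, map_smul]
    simp only [h, ← Finset.smul_sum, ← map_sum, Module.Basis.coord_apply]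
    rw [Module.Basis.sum_repr, degreeProj_of_mem (map_mem_exteriorPower _ (hY q)),
      map_dChartSymm_map_dChart hq]
  · simp [image_eq_zero_of_notMem_tsupport hqx]

/-- Inside any neighborhood of a point there is a smooth bump function equal to `1` nearby. -/
theorem exists_cutoff [T2Space M] {x q : M} (hq : q ∈ (chartAt E x).source) :
    ∃ χ : C^∞⟮𝓘(ℝ, E), M; ℝ⟯, tsupport χ ⊆ (chartAt E x).source ∧ ∀ᶠ p in 𝓝 q, χ p = 1 := by
  obtain ⟨χ, hχ⟩ := (SmoothBumpFunction.nhds_basis_support (I := 𝓘(ℝ, E))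
    ((chartAt E x).open_source.mem_nhds hq)).ex_mem
  exact ⟨⟨χ, χ.contMDiff⟩, hχ, χ.eventuallyEq_one⟩

end Extension

/-! ### From function-linear maps to differential forms. -/

section Tensoriality

open Set Filter Topology

variable {E : Type*} [NormedAddCommGroup E] [NormedSpace ℝ E] [FiniteDimensional ℝ E]
  {M : Type*} [TopologicalSpace M] [ChartedSpace E M] [IsManifold 𝓘(ℝ, E) ∞ M] [T2Space M]

/-- Forms of degree `m` are determined by their values on `m`-vector fields. -/
theorem DForm.ext_of_ofDegree {m : ℤ} {η η' : DForm E M} (hη : η ∈ DForm.ofDegree E M m)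
    (hη' : η' ∈ DForm.ofDegree E M m)
    (h : ∀ Y ∈ MVF.ofDegree E M m, ∀ p : M, η.1 p (Y.1 p) = η'.1 p (Y.1 p)) : η = η' := by
  refine Subtype.ext (funext fun p => ExteriorAlgebra.lhom_ext fun j => ?_)
  ext v
  simp only [LinearMap.compAlternatingMap_apply]
  have hv : ExteriorAlgebra.ιMulti ℝ j v ∈ gradedPart (TangentSpace 𝓘(ℝ, E) p) (j : ℤ) :=
    ιMulti_mem_exteriorPower v
  by_cases hj : (j : ℤ) = m
  · subst hj
    have hp := mem_chart_source E p
    obtain ⟨χ, hχ, hχ1⟩ := exists_cutoff hp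
    have := h _ (cutoffMVF_mem hχ (map_mem_gradedPart (dChart E M p p) hv)) p
    rwa [cutoffMVF_apply, hχ1.self_of_nhds, one_smul, map_dChartSymm_map_dChart hp] at this
  · rw [hη _ hj p _ hv, hη' _ hj p _ hv]

/-- A `C^∞(M)`-linear map from `n`-vector fields to functions is given by an `n`-form. -/
theorem exists_form_of_tensorial {n : ℕ} (T : MVF E M → M → ℝ)
    (hadd : ∀ Y ∈ MVF.ofDegree E M n, ∀ Y' ∈ MVF.ofDegree E M n, T (Y + Y') = T Y + T Y')
    (hsmul : ∀ (f : C^∞⟮𝓘(ℝ, E), M; ℝ⟯), ∀ Y ∈ MVF.ofDegree E M n,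
      T (f • Y) = fun p => f p * T Y p)
    (hT : ∀ Y ∈ MVF.ofDegree E M n, ContMDiff 𝓘(ℝ, E) 𝓘(ℝ, ℝ) ∞ (T Y)) :
    ∃ η ∈ DForm.ofDegree E M (n : ℤ),
      ∀ Y ∈ MVF.ofDegree E M n, ∀ p : M, η.1 p (Y.1 p) = T Y p := by
  have hsmem : ∀ (f : C^∞⟮𝓘(ℝ, E), M; ℝ⟯), ∀ Y ∈ MVF.ofDegree E M n,
      f • Y ∈ MVF.ofDegree E M (n : ℤ) := fun f Y hY p => Submodule.smul_mem _ _ (hY p)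
  have hsum : ∀ (t : Finset (Finset (Fin (Module.finrank ℝ E)))) (F : _ → MVF E M),
      (∀ s, F s ∈ MVF.ofDegree E M (n : ℤ)) → T (∑ s ∈ t, F s) = ∑ s ∈ t, T (F s) := by
    intro t F hF
    induction t using Finset.induction_on with
    | empty =>
      -- Additivity at `0 + 0` forces `T 0 = 0`.
      have h := hadd 0 (zero_mem _) 0 (zero_mem _)
      simpa using h
    | insert s t hs ih =>
      rw [Finset.sum_insert hs, Finset.sum_insert hs, hadd _ (hF s) _ (sum_mem fun s _ => hF s), ih]
  choose χ hχ hχ1 using fun p : M => exists_cutoff (mem_chart_source E p)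
  have hmem : ∀ s, degreeProj E n (extBasis E s) ∈ gradedPart E (n : ℤ) := fun s =>
    degreeProj_mem n _
  -- The coefficients are the values of `T` on the cut-off frame at its centre; the projection makes
  -- `η` vanish in all degrees other than `n`.
  let η : RawForm E M := fun p => ∑ s,
    T (cutoffMVF p (χ p) (hχ p) (degreeProj E n (extBasis E s))) p •
    ((extBasis E).coord s ∘ₗ (ExteriorAlgebra.map (dChart E M p p)).toLinearMap ∘ₗ degreeProj _ n)
  have hη_apply : ∀ p z, η p z =
      ∑ s, T (cutoffMVF p (χ p) (hχ p) (degreeProj E n (extBasis E s))) p *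
        (extBasis E).coord s (ExteriorAlgebra.map (dChart E M p p) (degreeProj _ n z)) := by
    intro p z
    simp only [η, LinearMap.sum_apply, LinearMap.smul_apply, smul_eq_mul]
    rfl
  have hη : ∀ Y ∈ MVF.ofDegree E M n, ∀ p : M, η p (Y.1 p) = T Y p := by
    intro Y hY p
    -- As `χ p` equals `1` at `p`, function-linearity allows the two cut-offs to be inserted freely,
    -- so no separate locality argument for `T` is needed.
    have h1 : T (χ p • χ p • Y) p = T Y p := by
      rw [hsmul _ _ (hsmem _ _ hY), hsmul _ _ hY]
      simp [(hχ1 p).self_of_nhds]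
    rw [← h1, smul_smul_eq_sum_cutoff (hχ p) hY,
      hsum _ _ fun s => hsmem _ _ (cutoffMVF_mem _ (hmem s)), Finset.sum_apply, hη_apply,
      degreeProj_of_mem (hY p)]
    refine Finset.sum_congr rfl fun s _ => ?_
    rw [hsmul _ _ (cutoffMVF_mem _ (hmem s))]
    dsimp only
    rw [cutoffCoord_apply, (hχ1 p).self_of_nhds, one_mul,
      mul_comm]
  have hproj : ∀ p z, η p (degreeProj _ n z) = η p z := by
    intro p z
    rw [hη_apply, hη_apply, degreeProj_of_mem (degreeProj_mem n z)]
  -- The frame defining `η` varies with the point, so its smoothness is not visible from the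
  -- formula. Near `q`, however, its value on a constant-coefficient field equals `T` of one fixed
  -- global field, which is smooth.
  have hsmooth : η.IsSmooth := by
    intro x c q hq
    obtain ⟨ψ, hψ, hψ1⟩ := exists_cutoff hq
    have hY := cutoffMVF_mem (M := M) hψ (m := n) (degreeProj_mem n c)
    refine ((hT _ hY q).congr_of_eventuallyEq ?_).contMDiffWithinAt
    filter_upwards [hψ1] with p hp
    rw [← hη _ hY, cutoffMVF_apply, hp, one_smul, map_degreeProj, hproj]
  refine ⟨⟨η, hsmooth⟩, fun j hj p v hv => ?_, hη⟩
  change η p v = 0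
  rw [← hproj]
  cases j with
  | ofNat m => rw [degreeProj_of_mem_ne (fun h => hj (by rw [h]; rfl)) hv, map_zero]
  | negSucc m =>
    have h0 : v = 0 := hv
    rw [h0, map_zero, map_zero]

end Tensoriality

end HigherConn

/-! ### The theorem. -/

theorem mainTheorem6
    {E : Type*} [NormedAddCommGroup E] [NormedSpace ℝ E] [FiniteDimensional ℝ E]
    {M : Type*} [TopologicalSpace M] [ChartedSpace E M] [IsManifold 𝓘(ℝ, E) ∞ M]
    [T2Space M] [SecondCountableTopology M]
    (C : HigherConn.HigherConnection E M) (k l : ℤ) (hk : 0 < k)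
    (X : HigherConn.MVF E M) (hX : X ∈ HigherConn.MVF.ofDegree E M k)
    (α : HigherConn.DForm E M) (hα : α ∈ HigherConn.DForm.ofDegree E M l) :
    (∀ Y ∈ HigherConn.MVF.ofDegree E M (l - k + 1),
      ∀ Y' ∈ HigherConn.MVF.ofDegree E M (l - k + 1),
        C.covForm k l X α (Y + Y') = C.covForm k l X α Y + C.covForm k l X α Y') ∧
    (∀ (f : C^∞⟮𝓘(ℝ, E), M; ℝ⟯), ∀ Y ∈ HigherConn.MVF.ofDegree E M (l - k + 1),
        C.covForm k l X α (f • Y) = fun p => f p * C.covForm k l X α Y p) ∧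
    (∃! η : HigherConn.DForm E M, η ∈ HigherConn.DForm.ofDegree E M (l - k + 1) ∧
      ∀ Y ∈ HigherConn.MVF.ofDegree E M (l - k + 1), ∀ p : M,
        η.1 p (Y.1 p) = C.covForm k l X α Y p) := by
  refine ⟨fun Y _ Y' _ => C.covForm_add k l X α Y Y', fun f Y hY => C.covForm_smul hk hX α f hY,
    ?_⟩
  have hex : ∃ η ∈ HigherConn.DForm.ofDegree E M (l - k + 1),
      ∀ Y ∈ HigherConn.MVF.ofDegree E M (l - k + 1), ∀ p : M,
        η.1 p (Y.1 p) = C.covForm k l X α Y p := by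
    have hsmul := fun (f : C^∞⟮𝓘(ℝ, E), M; ℝ⟯) Y hY =>
      C.covForm_smul (l := l) (Y := Y) hk hX α f hY
    -- Linearity is recorded beforehand because it depends on the degree being `l - k + 1`;
    -- afterwards only the sign of the degree matters.
    generalize l - k + 1 = m at hsmul ⊢
    cases m with
    | ofNat n =>
      exact HigherConn.exists_form_of_tensorial (C.covForm k l X α)
        (fun Y _ Y' _ => C.covForm_add k l X α Y Y') hsmul
        fun Y _ => C.contMDiff_covForm k l X α Y
    | negSucc n =>
      -- In negative degree the only field is `0`, and additivity makes the expression vanish there.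
      refine ⟨0, zero_mem _, fun Y hY p => ?_⟩
      have hY0 : Y = 0 := Subtype.ext (funext hY)
      have h := congrFun (C.covForm_add k l X α 0 0) p
      rw [add_zero, Pi.add_apply, left_eq_add] at h
      rw [hY0, h]
      rfl
  obtain ⟨η, hη, hηY⟩ := hex
  exact ⟨η, ⟨hη, hηY⟩, fun η' h => HigherConn.DForm.ext_of_ofDegree h.1 hη fun Y hY p => by
    rw [h.2 Y hY p, hηY Y hY p]⟩
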